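/- Let $n,m\ge 0$ be integers, let $T\in\{0,1,2,\dots\}\cup\{\infty\}$ be the time horizon, let $A,P\in\mathbb R^{n\times n}$ and $B,Q\in\mathbb R^{n\times m}$ be constant matrices, and let $\epsilon,\sigma>0$. On a probability space let $x_t,d_t\in\mathbb R^n$, $u_t\in\mathbb R^m$ be random vectors with $$x_{t+1}=Ax_t+Bu_t+d_t,\qquad 0\le t<T,$$ where $x_0$ is an arbitrary random vector, and let $\mathcal F_t$ be the $\sigma$-algebra generated by $x_0,\dots,x_t,u_0,\dots,u_t,d_0,\dots,d_{t-1}$. Assume the following. (Gaussian input) The inputs $u_t$, $0\le t<T$, are independent and identically distributed with law $N(0,\sigma^2\mathbf I_m)$, and for every $t$ with $t+1<T$ the input $u_{t+1}$ is independent of $\mathcal F_t\vee\sigma(d_t)$, where $\sigma(d_t)$ is the $\sigma$-algebra generated by $d_t$. (Attack model) There is a fixed (deterministic) set $S\subseteq\{t: 0\le t<T\}$ of attack times. For $t<T$, $t\notin S$, $d_t\sim N(0,\epsilon^2\mathbf I_n)$ is independent of $\mathcal F_t$. For $t\in S$, $d_t=Px_t+Qu_t+e_t$, where $e_t\sim N(0,\epsilon^2\mathbf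 I_n)$ is independent of $\mathcal F_t$. Let $\Gamma=\operatorname{diag}(\epsilon^2\mathbf I_n,\sigma^2\mathbf I_m)$. Then for every finite or infinite sequence of indices $0\le s_0<s_1<s_2<\cdots$ with all $s_t<T$ and every integer $k\ge 1$, the sub-process $V_t=[x_{s_t}^\top\; u_{s_t}^\top]^\top$ satisfies the $(k,\tfrac12\Gamma,\tfrac1{12})$ block martingale small ball (BMSB) condition with respect to the filtration $(\mathcal F_{s_t})_t$: the matrix $\tfrac12\Gamma$ is positive definite, and for every fixed $w\in\mathbb R^{n+m}$ with $\|w\|_2=1$ and every $j\ge 0$ (such that $V_{j+k}$ is defined, if the sequence is finite), $$\frac1k\sum_{i=1}^k\mathbb P\Big(|\langle w,V_{j+i}\rangle|^2\ge \tfrac12\,w^\top\Gamma w\,\Big|\,\mathcal F_{s_j}\Big)\ \ge\ \frac1{12}\qquad\text{almost surely.}$$ -/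

import Mathlib

open MeasureTheory ProbabilityTheory

noncomputable section

namespace AttackedLTI

/-- The σ-algebra `𝓕_t` of the data available up to time `t`:
`x_0, …, x_t`, `u_0, …, u_t`, `d_0, …, d_{t-1}`. -/
@[reducible]
def history {Ω : Type*} {n m : ℕ} (x : ℕ → Ω → EuclideanSpace ℝ (Fin n))
    (u : ℕ → Ω → EuclideanSpace ℝ (Fin m)) (d : ℕ → Ω → EuclideanSpace ℝ (Fin n))
    (t : ℕ) : MeasurableSpace Ω :=
  (⨆ r ≤ t, MeasurableSpace.comap (x r) inferInstance) ⊔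
  (⨆ r ≤ t, MeasurableSpace.comap (u r) inferInstance) ⊔
  (⨆ r < t, MeasurableSpace.comap (d r) inferInstance)

/-- The filtration `(𝓕_t)_{t ≥ 0}`. -/
def historyFiltration {Ω : Type*} [mΩ : MeasurableSpace Ω] {n m : ℕ}
    (x : ℕ → Ω → EuclideanSpace ℝ (Fin n)) (u : ℕ → Ω → EuclideanSpace ℝ (Fin m))
    (d : ℕ → Ω → EuclideanSpace ℝ (Fin n)) (hx : ∀ t, Measurable (x t))
    (hu : ∀ t, Measurable (u t)) (hd : ∀ t, Measurable (d t)) : Filtration ℕ mΩ where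
  seq := history x u d
  mono' := fun _ _ hab => sup_le_sup
    (sup_le_sup (biSup_mono fun _ h => le_trans h hab) (biSup_mono fun _ h => le_trans h hab))
    (biSup_mono fun _ h => lt_of_lt_of_le h hab)
  le' := fun _ => sup_le
    (sup_le (iSup₂_le fun r _ => (hx r).comap_le) (iSup₂_le fun r _ => (hu r).comap_le))
    (iSup₂_le fun r _ => (hd r).comap_le)

/-- The filtration `(𝓕_{s_t})_{t ≥ 0}` along a monotone sequence of indices. -/
def subFiltration {Ω : Type*} [mΩ : MeasurableSpace Ω] (F : Filtration ℕ mΩ) (s : ℕ → ℕ)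
    (hs : Monotone s) : Filtration ℕ mΩ where
  seq := fun t => F (s t)
  mono' := fun _ _ h => F.mono (hs h)
  le' := fun t => F.le (s t)

/-- The stacked vector `[xᵀ uᵀ]ᵀ ∈ ℝ^{n+m}`. -/
def stack {n m : ℕ} (x : EuclideanSpace ℝ (Fin n)) (u : EuclideanSpace ℝ (Fin m)) :
    EuclideanSpace ℝ (Fin n ⊕ Fin m) :=
  WithLp.toLp 2 (Sum.elim x u)

/-- `Γ = diag(ε² I_n, σ² I_m)`. -/
def Gam (n m : ℕ) (ε σ : ℝ) : Matrix (Fin n ⊕ Fin m) (Fin n ⊕ Fin m) ℝ :=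
  Matrix.fromBlocks (ε ^ 2 • 1) 0 0 (σ ^ 2 • 1)

/-- The `(k, Γ, p)` block martingale small ball condition for a process `V_t`, `0 ≤ t < N`, with
respect to the filtration `F`. For `N = ⊤` it is required at every `j ≥ 0`; for a process of
finite length `N` it is required at those `j` for which the block `V_{j+1}, …, V_{j+k}` lies
within the process. -/
def BMSB {Ω : Type*} [mΩ : MeasurableSpace Ω] {ι : Type*} [Fintype ι] (μ : Measure Ω)
    (N : ℕ∞) (F : Filtration ℕ mΩ) (V : ℕ → Ω → EuclideanSpace ℝ ι)
    (k : ℕ) (Γ : Matrix ι ι ℝ) (p : ℝ) : Prop :=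
  Γ.PosDef ∧
  ∀ w : EuclideanSpace ℝ ι, ‖w‖ = 1 → ∀ j : ℕ, ((j + k : ℕ) : ℕ∞) < N →
    ∀ᵐ ω ∂μ, p ≤ (1 / (k : ℝ)) * ∑ i ∈ Finset.Icc 1 k,
      (μ⟦{ω' | w.ofLp ⬝ᵥ Γ.mulVec w.ofLp ≤ |inner ℝ w (V (j + i) ω')| ^ 2} | F j⟧) ω

/-- The system `x_{t+1} = A x_t + B u_t + d_t`, `0 ≤ t < T`. -/
def Dynamics {Ω : Type*} {n m : ℕ} (T : ℕ∞) (A : Matrix (Fin n) (Fin n) ℝ)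
    (B : Matrix (Fin n) (Fin m) ℝ) (x : ℕ → Ω → EuclideanSpace ℝ (Fin n))
    (u : ℕ → Ω → EuclideanSpace ℝ (Fin m)) (d : ℕ → Ω → EuclideanSpace ℝ (Fin n)) : Prop :=
  ∀ t : ℕ, (t : ℕ∞) < T → ∀ ω,
    x (t + 1) ω = A.toEuclideanLin (x t ω) + B.toEuclideanLin (u t ω) + d t ω

/-- The inputs `u_t`, `0 ≤ t < T`, are i.i.d. `N(0, σ² I_m)`, and each new input is drawn
independently of the past states, inputs and disturbances. -/
structure GaussianInput {Ω : Type*} [MeasurableSpace Ω] {n m : ℕ} (μ : Measure Ω) (T : ℕ∞)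
    (σ : ℝ) (x : ℕ → Ω → EuclideanSpace ℝ (Fin n))
    (u : ℕ → Ω → EuclideanSpace ℝ (Fin m)) (d : ℕ → Ω → EuclideanSpace ℝ (Fin n)) : Prop where
  law : ∀ t : ℕ, (t : ℕ∞) < T → HasLaw (u t) (multivariateGaussian 0 (σ ^ 2 • 1)) μ
  iIndep : iIndepFun (fun t : {t : ℕ // (t : ℕ∞) < T} => u t) μ
  indep_past : ∀ t : ℕ, ((t + 1 : ℕ) : ℕ∞) < T →
    Indep (MeasurableSpace.comap (u (t + 1)) inferInstance)
      (history x u d t ⊔ MeasurableSpace.comap (d t) inferInstance) μ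

/-- The attack model: `S` is a deterministic set of attack times. For `t ∉ S`, `d_t` is a noise
`N(0, ε² I_n)`, independent of `𝓕_t`. For `t ∈ S`, `d_t = P x_t + Q u_t + e_t` with constant
matrices `P`, `Q` and `e_t ∼ N(0, ε² I_n)` independent of `𝓕_t`. -/
structure AttackModel {Ω : Type*} [MeasurableSpace Ω] {n m : ℕ} (μ : Measure Ω) (T : ℕ∞)
    (S : Set ℕ) (ε : ℝ) (P : Matrix (Fin n) (Fin n) ℝ) (Q : Matrix (Fin n) (Fin m) ℝ)
    (x : ℕ → Ω → EuclideanSpace ℝ (Fin n)) (u : ℕ → Ω → EuclideanSpace ℝ (Fin m))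
    (d e : ℕ → Ω → EuclideanSpace ℝ (Fin n)) : Prop where
  times : ∀ t ∈ S, (t : ℕ∞) < T
  noise_law : ∀ t : ℕ, (t : ℕ∞) < T → t ∉ S →
    HasLaw (d t) (multivariateGaussian 0 (ε ^ 2 • 1)) μ
  noise_indep : ∀ t : ℕ, (t : ℕ∞) < T → t ∉ S →
    Indep (MeasurableSpace.comap (d t) inferInstance) (history x u d t) μ
  attack_eq : ∀ t ∈ S, ∀ ω,
    d t ω = P.toEuclideanLin (x t ω) + Q.toEuclideanLin (u t ω) + e t ω
  attack_law : ∀ t ∈ S, HasLaw (e t) (multivariateGaussian 0 (ε ^ 2 • 1)) μ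
  attack_indep : ∀ t ∈ S,
    Indep (MeasurableSpace.comap (e t) inferInstance) (history x u d t) μ

end AttackedLTI

end

open AttackedLTI

namespace AttackedLTI

open scoped ENNReal NNReal

/-! Every time after `s j` has the form `t + 1` with `s j ≤ t`. An attack only adds a linear
function of `x t` and `u t`, so attacked or not, the state at `t + 1` is an `𝓕_t`-measurable vector
plus fresh `N(0, ε² I)` noise (`exists_state_eq_add_noise`). The input `u (t + 1)` is Gaussian and
independent of `𝓕_t` and that noise jointly. Hence `⟨w, V⟩` is an `𝓕_t`-measurable shift plus a
centred Gaussian of variance `v = wᵀΓw > 0` independent of `𝓕_t`.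

The density bound puts mass at most `11/12` on `|z|² < v/2`, uniformly in the shift
(`gaussianReal_ball_compl_ge`). Uniformity turns this into a bound on the probability conditional on
`𝓕_t` or any coarser σ-algebra, such as `𝓕_{s_j}` (`le_condExp_add_of_indepFun`). Each term of the
block average is thus at least `1/12`. -/

/-- If `X` is independent of `Y` and `(X, Y)` is independent of `Z`, then `X` is independent of
`(Y, Z)`. -/
theorem indepFun_prodMk_of_prodMk_indepFun {Ω α β γ : Type*} {mΩ : MeasurableSpace Ω}
    {mα : MeasurableSpace α} {mβ : MeasurableSpace β} {mγ : MeasurableSpace γ} {μ : Measure Ω}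
    [IsProbabilityMeasure μ] {X : Ω → α} {Y : Ω → β} {Z : Ω → γ}
    (hX : Measurable X) (hY : Measurable Y) (hZ : Measurable Z)
    (hXY : IndepFun X Y μ) (hXYZ : IndepFun (fun ω => (X ω, Y ω)) Z μ) :
    IndepFun X (fun ω => (Y ω, Z ω)) μ := by
  have := Measure.isProbabilityMeasure_map (μ := μ) hX.aemeasurable
  have := Measure.isProbabilityMeasure_map (μ := μ) hY.aemeasurable
  have := Measure.isProbabilityMeasure_map (μ := μ) hZ.aemeasurable
  have hYZ : IndepFun Y Z μ := hXYZ.comp measurable_snd measurable_id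
  rw [indepFun_iff_map_prod_eq_prod_map_map hX.aemeasurable (hY.prodMk hZ).aemeasurable,
    (indepFun_iff_map_prod_eq_prod_map_map hY.aemeasurable hZ.aemeasurable).1 hYZ,
    ← Measure.prodAssoc_prod,
    ← (indepFun_iff_map_prod_eq_prod_map_map hX.aemeasurable hY.aemeasurable).1 hXY,
    ← (indepFun_iff_map_prod_eq_prod_map_map (hX.prodMk hY).aemeasurable hZ.aemeasurable).1 hXYZ,
    Measure.map_map MeasurableEquiv.prodAssoc.measurable ((hX.prodMk hY).prodMk hZ)]
  rfl

/-- Lower bound for the conditional probability that `a(X) + g` lies in `C`, given a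
sub-σ-algebra of `σ(X)`, when `g` is independent of `X`: it suffices to bound the probability of
every translate of `C` under the law of `g`. -/
theorem le_condExp_add_of_indepFun {Ω α : Type*} {G mΩ : MeasurableSpace Ω}
    {mα : MeasurableSpace α} {μ : Measure Ω} [IsProbabilityMeasure μ] {X : Ω → α} {g : Ω → ℝ}
    (hG : G ≤ mα.comap X) (hX : Measurable X) (hg : Measurable g) (hind : IndepFun X g μ)
    {a : α → ℝ} (ha : Measurable a) {C : Set ℝ} (hC : MeasurableSet C) {p : ℝ}
    (hp : ∀ c, ENNReal.ofReal p ≤ μ.map g {y | c + y ∈ C}) :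
    ∀ᵐ ω ∂μ, p ≤ (μ⟦{ω' | a (X ω') + g ω' ∈ C} | G⟧) ω := by
  have hGm : G ≤ mΩ := hG.trans hX.comap_le
  set E := {ω' | a (X ω') + g ω' ∈ C}
  have hE : MeasurableSet E := ((ha.comp hX).add hg) hC
  have hint : Integrable (E.indicator fun _ => (1 : ℝ)) μ := (integrable_const 1).indicator hE
  have := Measure.isProbabilityMeasure_map (μ := μ) hX.aemeasurable
  have := Measure.isProbabilityMeasure_map (μ := μ) hg.aemeasurable
  -- The bound is tested on sets of `G`, which are preimages under `X`. By independence the joint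
  -- law is a product, and its slice over `z` is the translate of `C` by `a z`.
  have key : ∀ s, MeasurableSet[G] s → ENNReal.ofReal p * μ s ≤ μ (E ∩ s) := by
    intro s hs
    obtain ⟨B, hB, rfl⟩ := hG s hs
    have hD : MeasurableSet {q : α × ℝ | a q.1 + q.2 ∈ C ∧ q.1 ∈ B} :=
      (((ha.comp measurable_fst).add measurable_snd) hC).inter (measurable_fst hB)
    have h1 : μ (E ∩ X ⁻¹' B) =
        μ.map (fun ω => (X ω, g ω)) {q : α × ℝ | a q.1 + q.2 ∈ C ∧ q.1 ∈ B} := by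
      rw [Measure.map_apply (hX.prodMk hg) hD]
      rfl
    rw [h1, (indepFun_iff_map_prod_eq_prod_map_map hX.aemeasurable hg.aemeasurable).1 hind,
      Measure.prod_apply hD, ← Measure.map_apply hX hB, ← lintegral_indicator_const hB]
    refine lintegral_mono fun z => ?_
    by_cases hz : z ∈ B
    · simpa [hz] using hp (a z)
    · simp [hz]
  have hle : (fun _ => p) ≤ᵐ[μ.trim hGm] μ[E.indicator fun _ => (1 : ℝ) | G] := by
    refine ae_le_of_forall_setIntegral_le (integrable_const p)
      (integrable_condExp.trim hGm stronglyMeasurable_condExp) fun s hs _ => ?_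
    rw [← setIntegral_trim hGm stronglyMeasurable_condExp hs, setIntegral_condExp hGm hint hs,
      setIntegral_const, integral_indicator_const _ hE, measureReal_restrict_apply hE,
      measureReal_def, measureReal_def, trim_measurableSet_eq hGm hs, smul_eq_mul, smul_eq_mul,
      mul_one, mul_comm]
    have h := ENNReal.toReal_mono (measure_ne_top _ _) (key s hs)
    rw [ENNReal.toReal_mul] at h
    refine (mul_le_mul_of_nonneg_right ?_ ENNReal.toReal_nonneg).trans h
    -- The truncation gives `max p 0`, so no sign condition on `p` is needed.
    rw [ENNReal.toReal_ofReal']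
    exact le_max_left _ _
  exact ae_le_of_ae_le_trim hle

/-! ### Gaussian estimates -/

/-- A Gaussian of variance `v`, shifted arbitrarily, has square at least `v / 2` with probability at
least `1/12`. -/
theorem gaussianReal_ball_compl_ge {v : ℝ≥0} (hv : v ≠ 0) (c : ℝ) :
    ENNReal.ofReal (1 / 12) ≤ gaussianReal 0 v {y | c + y ∈ {z : ℝ | (v : ℝ) / 2 ≤ |z| ^ 2}} := by
  have hv0 : (0 : ℝ) < v := by positivity
  set r := √((v : ℝ) / 2)
  have hr : 0 < r := by positivity
  have hr2 : r ^ 2 = v / 2 := Real.sq_sqrt (by positivity)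
  have hset : {y | c + y ∈ {z : ℝ | (v : ℝ) / 2 ≤ |z| ^ 2}} = (Set.Ioo (-c - r) (-c + r))ᶜ := by
    ext y
    have : |c + y| ^ 2 < (v : ℝ) / 2 ↔ y ∈ Set.Ioo (-c - r) (-c + r) := by
      rw [← hr2, sq_lt_sq₀ (abs_nonneg _) hr.le, abs_lt, Set.mem_Ioo]
      constructor <;> rintro ⟨h1, h2⟩ <;> constructor <;> linarith
    simp only [Set.mem_ofPred_eq, Set.mem_compl_iff, ← this, not_lt]
  have hball : gaussianReal 0 v (Set.Ioo (-c - r) (-c + r)) ≤ ENNReal.ofReal (11 / 12) := by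
    have hpdf : ∀ y, gaussianPDF 0 v y ≤ ENNReal.ofReal (√(2 * Real.pi * v))⁻¹ := by
      intro y
      refine ENNReal.ofReal_le_ofReal ?_
      rw [gaussianPDFReal_def]
      refine mul_le_of_le_one_right (by positivity) (Real.exp_le_one_iff.2 ?_)
      rw [neg_div, neg_nonpos]
      positivity
    rw [gaussianReal_apply _ hv]
    refine (lintegral_mono hpdf).trans ?_
    rw [lintegral_const, Measure.restrict_apply_univ, Real.volume_Ioo,
      ← ENNReal.ofReal_mul (by positivity)]
    refine ENNReal.ofReal_le_ofReal ?_
    -- `24/11` is the interval length factor `2` divided by `11/12`. The bound is loose: the true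
    -- ratio `2r / √(2πv)` is `1/√π`.
    have hs : √(2 * Real.pi * v) ≥ 24 / 11 * r := by
      refine Real.le_sqrt_of_sq_le ?_
      rw [mul_pow, hr2]
      nlinarith [Real.pi_gt_three]
    have hs0 : 0 < √(2 * Real.pi * v) := by positivity
    rw [inv_mul_le_iff₀ hs0]
    linarith
  rw [hset, prob_compl_eq_one_sub measurableSet_Ioo]
  refine le_trans ?_ (tsub_le_tsub_left hball 1)
  rw [← ENNReal.ofReal_one, ← ENNReal.ofReal_sub _ (by norm_num)]
  exact ENNReal.ofReal_le_ofReal (by norm_num)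

/-- The marginals of `N(0, r² I)` are the Gaussians `N(0, r²‖w‖²)`. -/
theorem map_inner_multivariateGaussian {ι : Type*} [Fintype ι] [DecidableEq ι] (r : ℝ)
    (w : EuclideanSpace ℝ ι) :
    (multivariateGaussian 0 (r ^ 2 • (1 : Matrix ι ι ℝ))).map (fun z => inner ℝ w z) =
      gaussianReal 0 (r ^ 2 * ‖w‖ ^ 2).toNNReal := by
  have hS : (r ^ 2 • (1 : Matrix ι ι ℝ)).PosSemidef :=
    Matrix.PosSemidef.one.smul (sq_nonneg r)
  refine Measure.ext_of_charFun ?_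
  ext t
  have h : charFun ((multivariateGaussian 0 (r ^ 2 • (1 : Matrix ι ι ℝ))).map
      (fun z => inner ℝ w z)) t = charFun (multivariateGaussian 0 (r ^ 2 • (1 : Matrix ι ι ℝ)))
        (t • w) := by
    rw [charFun_apply, charFun_apply, integral_map (by fun_prop) (by fun_prop)]
    simp [inner_smul_right, real_inner_comm]
  have hw : w.ofLp ⬝ᵥ w.ofLp = ‖w‖ ^ 2 := by
    rw [EuclideanSpace.real_norm_sq_eq]
    simp [dotProduct, sq]
  rw [h, charFun_multivariateGaussian hS, charFun_gaussianReal, Real.coe_toNNReal _ (by positivity)]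
  simp [Matrix.smul_mulVec, hw]
  ring_nf

/-! ### Splitting the state into past and fresh noise -/

section History

variable {Ω : Type*} {n m : ℕ} {x : ℕ → Ω → EuclideanSpace ℝ (Fin n)}
  {u : ℕ → Ω → EuclideanSpace ℝ (Fin m)} {d : ℕ → Ω → EuclideanSpace ℝ (Fin n)}

theorem measurable_state_history (t : ℕ) : Measurable[history x u d t] (x t) :=
  Measurable.of_comap_le (le_sup_of_le_left (le_sup_of_le_left
    (le_iSup₂_of_le (f := fun r (_ : r ≤ t) => MeasurableSpace.comap (x r) inferInstance)
      t le_rfl le_rfl)))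

theorem measurable_input_history (t : ℕ) : Measurable[history x u d t] (u t) :=
  Measurable.of_comap_le (le_sup_of_le_left (le_sup_of_le_right
    (le_iSup₂_of_le (f := fun r (_ : r ≤ t) => MeasurableSpace.comap (u r) inferInstance)
      t le_rfl le_rfl)))

end History

theorem measurable_toEuclideanLin {p q : ℕ} (M : Matrix (Fin p) (Fin q) ℝ) :
    Measurable (M.toEuclideanLin : EuclideanSpace ℝ (Fin q) → EuclideanSpace ℝ (Fin p)) :=
  (LinearMap.continuous_of_finiteDimensional _).measurable

/-- The state at time `t + 1` is an `𝓕_t`-measurable vector plus a fresh `N(0, ε² I)` noise, whether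
or not the system is attacked at time `t`. -/
theorem exists_state_eq_add_noise {Ω : Type*} [mΩ : MeasurableSpace Ω] {μ : Measure Ω}
    {n m : ℕ} {T : ℕ∞} {S : Set ℕ} {ε : ℝ}
    {A P : Matrix (Fin n) (Fin n) ℝ} {B Q : Matrix (Fin n) (Fin m) ℝ}
    {x : ℕ → Ω → EuclideanSpace ℝ (Fin n)} {u : ℕ → Ω → EuclideanSpace ℝ (Fin m)}
    {d e : ℕ → Ω → EuclideanSpace ℝ (Fin n)}
    (hdyn : Dynamics T A B x u d) (hattack : AttackModel μ T S ε P Q x u d e)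
    {t : ℕ} (ht : (t : ℕ∞) < T) :
    ∃ y ξ : Ω → EuclideanSpace ℝ (Fin n), Measurable[history x u d t] y ∧
      Measurable[history x u d t ⊔ MeasurableSpace.comap (d t) inferInstance] ξ ∧
      (∀ ω, x (t + 1) ω = y ω + ξ ω) ∧
      HasLaw ξ (multivariateGaussian 0 (ε ^ 2 • 1)) μ ∧
      Indep (MeasurableSpace.comap ξ inferInstance) (history x u d t) μ := by
  have hlin : ∀ (C : Matrix (Fin n) (Fin n) ℝ) (D : Matrix (Fin n) (Fin m) ℝ),
      Measurable[history x u d t]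
        fun ω => C.toEuclideanLin (x t ω) + D.toEuclideanLin (u t ω) := fun C D =>
    ((measurable_toEuclideanLin C).comp (measurable_state_history t)).add
      ((measurable_toEuclideanLin D).comp (measurable_input_history t))
  have hdm : Measurable[history x u d t ⊔ MeasurableSpace.comap (d t) inferInstance] (d t) :=
    Measurable.of_comap_le le_sup_right
  by_cases hS : t ∈ S
  · refine ⟨_, e t, (hlin A B).add (hlin P Q), ?_, fun ω => ?_, hattack.attack_law t hS,
      hattack.attack_indep t hS⟩
    -- Solving the attack equation for `e t` shows that it is determined by `𝓕_t` and `d t`, so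
    -- independence of the next input from these covers `e t` as well.
    · have : e t = fun ω => d t ω - (P.toEuclideanLin (x t ω) + Q.toEuclideanLin (u t ω)) := by
        funext ω
        rw [hattack.attack_eq t hS ω, add_sub_cancel_left]
      rw [this]
      exact hdm.sub ((hlin P Q).mono le_sup_left le_rfl)
    · rw [hdyn t ht ω, hattack.attack_eq t hS ω]
      simp only [Pi.add_apply, add_assoc]
  · exact ⟨_, d t, hlin A B, hdm, fun ω => hdyn t ht ω, hattack.noise_law t ht hS,
      hattack.noise_indep t ht hS⟩

/-! ### The stacked vector and its small-ball bound -/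

theorem inner_stack {n m : ℕ} (w : EuclideanSpace ℝ (Fin n ⊕ Fin m))
    (a : EuclideanSpace ℝ (Fin n)) (b : EuclideanSpace ℝ (Fin m)) :
    inner ℝ w (stack a b) = inner ℝ (WithLp.toLp 2 fun i => w (Sum.inl i)) a +
      inner ℝ (WithLp.toLp 2 fun i => w (Sum.inr i)) b := by
  simp [stack, PiLp.inner_apply, Fintype.sum_sum_type]

/-- The right-hand side is the sum of the variances of the state-noise and input contributions to
`⟨w, V⟩`. -/
theorem dotProduct_Gam_mulVec {n m : ℕ} (ε σ : ℝ) (w : EuclideanSpace ℝ (Fin n ⊕ Fin m)) :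
    w.ofLp ⬝ᵥ (Gam n m ε σ).mulVec w.ofLp =
      ε ^ 2 * ‖(WithLp.toLp 2 fun i => w (Sum.inl i) : EuclideanSpace ℝ (Fin n))‖ ^ 2 +
      σ ^ 2 * ‖(WithLp.toLp 2 fun i => w (Sum.inr i) : EuclideanSpace ℝ (Fin m))‖ ^ 2 := by
  simp only [Gam, EuclideanSpace.real_norm_sq_eq, Matrix.fromBlocks_mulVec, dotProduct,
    Fintype.sum_sum_type, Matrix.smul_mulVec, Finset.mul_sum]
  simp [Function.comp_def]
  congr 1 <;> refine Finset.sum_congr rfl fun i _ => ?_ <;> ring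

theorem posDef_Gam {n m : ℕ} {ε σ : ℝ} (hε : 0 < ε) (hσ : 0 < σ) : (Gam n m ε σ).PosDef := by
  have : Gam n m ε σ = Matrix.diagonal (Sum.elim (fun _ => ε ^ 2) fun _ => σ ^ 2) := by
    simp [Gam, ← Matrix.fromBlocks_diagonal, Matrix.smul_one_eq_diagonal]
  rw [this]
  refine Matrix.PosDef.diagonal ?_
  rintro (i | i)
  · exact pow_pos hε 2
  · exact pow_pos hσ 2

/-- One-step small-ball bound: for an `F`-measurable `y` and fresh Gaussian vectors `ξ`, `v`, the
vector `[(y + ξ)ᵀ vᵀ]ᵀ` avoids the slab of squared half-width `wᵀ(Γ/2)w` with conditional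
probability at least `1/12`. -/
theorem one_div_twelve_le_condExp {Ω : Type*} {F G : MeasurableSpace Ω} [mΩ : MeasurableSpace Ω]
    {μ : Measure Ω} [IsProbabilityMeasure μ] {n m : ℕ} {ε σ : ℝ} (hε : 0 < ε) (hσ : 0 < σ)
    (hGF : G ≤ F) (hF : F ≤ mΩ) {y ξ : Ω → EuclideanSpace ℝ (Fin n)}
    {v : Ω → EuclideanSpace ℝ (Fin m)} (hy : Measurable[F] y) (hξ : Measurable ξ)
    (hv : Measurable v) (hξlaw : HasLaw ξ (multivariateGaussian 0 (ε ^ 2 • 1)) μ)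
    (hvlaw : HasLaw v (multivariateGaussian 0 (σ ^ 2 • 1)) μ)
    (hξF : Indep (MeasurableSpace.comap ξ inferInstance) F μ)
    (hvF : Indep (MeasurableSpace.comap v inferInstance)
      (F ⊔ MeasurableSpace.comap ξ inferInstance) μ)
    {w : EuclideanSpace ℝ (Fin n ⊕ Fin m)} (hw : w ≠ 0) :
    ∀ᵐ ω ∂μ, 1 / 12 ≤ (μ⟦{ω' | w.ofLp ⬝ᵥ ((1 / 2 : ℝ) • Gam n m ε σ).mulVec w.ofLp ≤
      |inner ℝ w (stack (y ω' + ξ ω') (v ω'))| ^ 2} | G⟧) ω := by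
  set w₁ : EuclideanSpace ℝ (Fin n) := WithLp.toLp 2 fun i => w (Sum.inl i)
  set w₂ : EuclideanSpace ℝ (Fin m) := WithLp.toLp 2 fun i => w (Sum.inr i)
  set V : ℝ≥0 := (ε ^ 2 * ‖w₁‖ ^ 2).toNNReal + (σ ^ 2 * ‖w₂‖ ^ 2).toNNReal with hVdef
  have hV : (V : ℝ) = w.ofLp ⬝ᵥ (Gam n m ε σ).mulVec w.ofLp := by
    rw [dotProduct_Gam_mulVec, hVdef, NNReal.coe_add, Real.coe_toNNReal _ (by positivity),
      Real.coe_toNNReal _ (by positivity)]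
  have hV0 : V ≠ 0 := by
    have hpos := (posDef_Gam (n := n) (m := m) hε hσ).dotProduct_mulVec_pos
      (x := w.ofLp) (by simpa using hw)
    rw [star_trivial, ← hV] at hpos
    exact_mod_cast hpos.ne'
  -- The σ-algebra `F` is encoded as the random variable `id` into `(Ω, F)`, so that lemmas about
  -- independent functions apply to it.
  have hid : @Measurable Ω Ω mΩ F id := measurable_id'' hF
  have hIF₁ : @IndepFun Ω Ω _ mΩ F _ id ξ μ := by
    change Indep (F.comap id) _ μ
    rw [MeasurableSpace.comap_id]
    exact hξF.symm
  have hIF₂ : @IndepFun Ω (Ω × EuclideanSpace ℝ (Fin n)) _ mΩ (F.prod inferInstance) _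
      (fun ω => (id ω, ξ ω)) v μ := by
    change Indep ((F.prod inferInstance).comap fun ω => (id ω, ξ ω)) _ μ
    rw [MeasurableSpace.comap_prodMk id ξ, MeasurableSpace.comap_id]
    exact hvF.symm
  have hIF := indepFun_prodMk_of_prodMk_indepFun hid hξ hv hIF₁ hIF₂
  have hg : Measurable fun q : EuclideanSpace ℝ (Fin n) × EuclideanSpace ℝ (Fin m) =>
      inner ℝ w₁ q.1 + inner ℝ w₂ q.2 := by fun_prop
  have hIg := @IndepFun.comp _ _ _ _ _ _ _ _ _ F _ F _ _ _ hIF (@measurable_id _ F) hg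
  have hξv : IndepFun ξ v μ :=
    hIF₂.comp (@measurable_snd _ _ F _) measurable_id
  have hmap : μ.map (fun ω => inner ℝ w₁ (ξ ω) + inner ℝ w₂ (v ω)) = gaussianReal 0 V := by
    have h := gaussianReal_add_gaussianReal_of_indepFun (P := μ)
      (X := fun ω => inner ℝ w₁ (ξ ω)) (Y := fun ω => inner ℝ w₂ (v ω))
      (hξv.comp (φ := fun z => inner ℝ w₁ z) (ψ := fun z => inner ℝ w₂ z)
        (by fun_prop) (by fun_prop))
      ((Measure.map_map (g := fun z => inner ℝ w₁ z) (by fun_prop) hξ).symm.trans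
        (by rw [hξlaw.map_eq, map_inner_multivariateGaussian]))
      ((Measure.map_map (g := fun z => inner ℝ w₂ z) (by fun_prop) hv).symm.trans
        (by rw [hvlaw.map_eq, map_inner_multivariateGaussian]))
    rw [zero_add] at h
    exact h
  have ha : Measurable[F] fun ω => inner ℝ w₁ (y ω) :=
    (by fun_prop : Measurable fun z => inner ℝ w₁ z).comp hy
  have hC : MeasurableSet {z : ℝ | (V : ℝ) / 2 ≤ |z| ^ 2} :=
    measurableSet_le measurable_const (by fun_prop)
  have hmain := le_condExp_add_of_indepFun (G := G) (p := 1 / 12)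
    (by rw [MeasurableSpace.comap_id]; exact hGF) hid (hg.comp (hξ.prodMk hv)) hIg ha hC
    (fun c => by
      have := gaussianReal_ball_compl_ge hV0 c
      rwa [← hmap] at this)
  have hset : {ω' | w.ofLp ⬝ᵥ ((1 / 2 : ℝ) • Gam n m ε σ).mulVec w.ofLp ≤
      |inner ℝ w (stack (y ω' + ξ ω') (v ω'))| ^ 2} =
      {ω' | inner ℝ w₁ (y ω') + (inner ℝ w₁ (ξ ω') + inner ℝ w₂ (v ω')) ∈
        {z : ℝ | (V : ℝ) / 2 ≤ |z| ^ 2}} := by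
    ext ω'
    rw [Set.mem_ofPred_eq, Set.mem_ofPred_eq, Set.mem_ofPred_eq, inner_stack, inner_add_right,
      Matrix.smul_mulVec, dotProduct_smul, ← hV, smul_eq_mul, one_div_mul_eq_div, add_assoc]
  rw [hset]
  exact hmain

end AttackedLTI

theorem lemma5 {Ω : Type*} [MeasurableSpace Ω] (μ : Measure Ω) [IsProbabilityMeasure μ]
    {n m : ℕ} (T : ℕ∞) (S : Set ℕ) (ε σ : ℝ) (hε : 0 < ε) (hσ : 0 < σ)
    (A P : Matrix (Fin n) (Fin n) ℝ) (B Q : Matrix (Fin n) (Fin m) ℝ)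
    (x : ℕ → Ω → EuclideanSpace ℝ (Fin n)) (u : ℕ → Ω → EuclideanSpace ℝ (Fin m))
    (d e : ℕ → Ω → EuclideanSpace ℝ (Fin n))
    (hx : ∀ t, Measurable (x t)) (hu : ∀ t, Measurable (u t)) (hd : ∀ t, Measurable (d t))
    (hdyn : Dynamics T A B x u d)
    (hinput : GaussianInput μ T σ x u d)
    (hattack : AttackModel μ T S ε P Q x u d e)
    (s : ℕ → ℕ) (hs : StrictMono s) (N : ℕ∞) (hN : ∀ t : ℕ, (t : ℕ∞) < N → (s t : ℕ∞) < T)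
    (k : ℕ) (hk : 1 ≤ k) :
    BMSB μ N (subFiltration (historyFiltration x u d hx hu hd) s hs.monotone)
      (fun t ω => stack (x (s t) ω) (u (s t) ω)) k ((1 / 2 : ℝ) • Gam n m ε σ) (1 / 12) := by
  refine ⟨(posDef_Gam hε hσ).smul (by norm_num), fun w hw j hj => ?_⟩
  have hw0 : w ≠ 0 := by
    rintro rfl
    simp at hw
  have hterm : ∀ i ∈ Finset.Icc 1 k, ∀ᵐ ω ∂μ, 1 / 12 ≤
      (μ⟦{ω' | w.ofLp ⬝ᵥ ((1 / 2 : ℝ) • Gam n m ε σ).mulVec w.ofLp ≤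
        |inner ℝ w (stack (x (s (j + i)) ω') (u (s (j + i)) ω'))| ^ 2} |
        subFiltration (historyFiltration x u d hx hu hd) s hs.monotone j⟧) ω := by
    intro i hi
    obtain ⟨hi1, hik⟩ := Finset.mem_Icc.1 hi
    have hlt : s j < s (j + i) := hs (by lia)
    -- Since `i ≥ 1`, the sampled time has a predecessor `t` no earlier than `s j`; conditioning at
    -- `𝓕_t` is therefore at least as fine as at `𝓕_{s_j}`.
    obtain ⟨t, ht⟩ : ∃ t, s (j + i) = t + 1 := ⟨s (j + i) - 1, by lia⟩
    have hT : ((t + 1 : ℕ) : ℕ∞) < T :=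
      ht ▸ hN (j + i) (lt_of_le_of_lt (by exact_mod_cast (by lia : j + i ≤ j + k)) hj)
    have htT : (t : ℕ∞) < T := lt_trans (by exact_mod_cast t.lt_succ_self) hT
    obtain ⟨y, ξ, hy, hξ, hstate, hlaw, hind⟩ := exists_state_eq_add_noise hdyn hattack htT
    have hFle := (historyFiltration x u d hx hu hd).le t
    have hmono := (historyFiltration x u d hx hu hd).mono (by lia : s j ≤ t)
    have := one_div_twelve_le_condExp hε hσ hmono hFle hy
      (hξ.mono (sup_le hFle (hd t).comap_le) le_rfl) (hu (t + 1)) hlaw (hinput.law _ hT) hind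
      (indep_of_indep_of_le_right (hinput.indep_past t hT) (sup_le le_sup_left hξ.comap_le)) hw0
    simp only [ht, hstate]
    exact this
  -- The block is finite, so the exceptional null sets merge into one, and averaging preserves the
  -- termwise bound.
  have hall := (ae_ball_iff (Finset.Icc 1 k).countable_toSet).2 hterm
  filter_upwards [hall] with ω hω
  have hsum := Finset.card_nsmul_le_sum (Finset.Icc 1 k) _ _ hω
  have hk0 : (0 : ℝ) < k := by exact_mod_cast hk
  rw [Nat.card_Icc, Nat.add_sub_cancel, nsmul_eq_mul] at hsum
  rw [one_div_mul_eq_div, le_div_iff₀ hk0, mul_comm]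
  exact hsum
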